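/- For $p\in 2^{\mathbb N}$ let $\mathrm{MLR}(p)$ be the set of points of $2^{\mathbb N}$ that are Martin-Löf random relative to $p$, that is, that lie outside $\bigcap_n V_n$ for every sequence $(V_n)_n$ of open subsets of $2^{\mathbb N}$ that is uniformly c.e. in $p$ and satisfies $\mu(V_n)\le 2^{-n}$ for all $n$, where $\mu$ is the uniform measure. Let $U$ be a universal (optimal) prefix-free machine, and let $\Omega\in 2^{\mathbb N}$ be its Chaitin number, i.e. the sequence of binary digits of the halting probability $\sum_{\sigma\in\mathrm{dom}(U)}2^{-|\sigma|}$. A point $p\in 2^{\mathbb N}$ is called low for $\Omega$ if $\Omega\in\mathrm{MLR}(p)$. A set $A\subseteq 2^{\mathbb N}$ is called co-c.e. comeager if $2^{\mathbb N}\setminus A=\bigcup_{i=0}^\infty A_i$ for a sequence $(A_i)_i$ of nowhere dense closed sets that is computable with respect to positive information, i.e. such that there is a computable double sequence $(x_{i,j})_{i,j}$ in $2^{\mathbb N}\sqcup\{\infty\}$ (where $\infty$ is an isolated dummy point, so that "$x_{i,j}=\infty$" is decidable) with $A_i=\overline{\{x_{i,j}: j\in\mathbb N\}\cap 2^{\mathbb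 N}}$ for all $i$. **Proposition.** There is a co-c.e. comeager set $A\subseteq 2^{\mathbb N}$ such that no point of $A$ is low for $\Omega$. -/

import Mathlib

namespace LowForOmega

/-- Cantor space `2^ℕ`, with the product topology and the product σ-algebra. -/
abbrev Cantor : Type := ℕ → Bool

/-! ### Positive information on closed sets and co-c.e. comeager sets -/

/-- `x` is a computable double sequence in the coproduct `2^ℕ ⊔ {∞}`, where `none` stands for the
isolated dummy point `∞`: from `i, j, k` one can compute whether `x i j = ∞` and, if this is not
the case, the bit number `k` of the point `x i j` of Cantor space. -/
def IsComputableDoubleSeq (x : ℕ → ℕ → Option Cantor) : Prop :=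
  Computable fun t : ℕ × ℕ × ℕ => (x t.1 t.2.1).map fun y : Cantor => y t.2.2

/-- `(B i)` is a computable sequence in the hyperspace `𝒜₊(2^ℕ)` of closed subsets of Cantor space
represented by positive information: uniformly in `i` one can compute a sequence `(x i j)_j` in
`2^ℕ ⊔ {∞}` such that `B i` is the closure of the set of those `x i j` which are points of `2^ℕ`.
(The point `∞` conveys no information and allows `B i` to be empty.) -/
def IsComputableSeqPos (B : ℕ → Set Cantor) : Prop :=
  ∃ x : ℕ → ℕ → Option Cantor, IsComputableDoubleSeq x ∧
    ∀ i, B i = closure {y : Cantor | ∃ j, x i j = some y}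

/-- `A ⊆ 2^ℕ` is co-c.e. comeager: its complement is the union of a computable sequence of nowhere
dense closed sets, the closed sets being represented by positive information. -/
def IsCoCEComeager (A : Set Cantor) : Prop :=
  ∃ B : ℕ → Set Cantor, IsComputableSeqPos B ∧ (∀ i, IsNowhereDense (B i)) ∧ Aᶜ = ⋃ i, B i

/-! ### Martin-Löf randomness relative to an oracle -/

/-- The point `p` of Cantor space as an oracle. -/
def oracle (p : Cantor) : ℕ →. ℕ :=
  fun n => Part.some (p n).toNat

/-- `S` is computably enumerable in `p`: it is the domain of a partial function that is recursive
in the oracle `p`. -/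
def IsCEIn {α : Type} [Primcodable α] (p : Cantor) (S : Set α) : Prop :=
  ∃ f : α →. Unit, RecursiveIn {oracle p} f ∧ ∀ a, a ∈ S ↔ (f a).Dom

/-- The cylinder `[σ]` of all points of Cantor space that extend the word `σ`. -/
def wordCylinder (σ : List Bool) : Set Cantor :=
  {x | ∀ (i : ℕ) (h : i < σ.length), x i = σ[i]}

/-- The uniform measure on Cantor space: the product of the fair coin measures. -/
noncomputable def uniformMeasure : MeasureTheory.Measure Cantor :=
  MeasureTheory.Measure.infinitePi fun _ : ℕ => (PMF.uniformOfFintype Bool).toMeasure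

/-- The open set `⋃ {[σ] : (n, σ) ∈ W}`. -/
def testComponent (W : Set (ℕ × List Bool)) (n : ℕ) : Set Cantor :=
  ⋃ σ ∈ {σ : List Bool | (n, σ) ∈ W}, wordCylinder σ

/-- `W` describes a Martin-Löf test relative to `p`: a sequence of open sets, uniformly c.e. in
`p`, the `n`-th of which has measure at most `2⁻ⁿ`. -/
def IsMLTest (p : Cantor) (W : Set (ℕ × List Bool)) : Prop :=
  IsCEIn p W ∧ ∀ n, uniformMeasure (testComponent W n) ≤ (2⁻¹ : ENNReal) ^ n

/-- `MLR(p)`: the set of all points that are Martin-Löf random relative to `p`. -/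
def MLR (p : Cantor) : Set Cantor :=
  {q | ∀ W : Set (ℕ × List Bool), IsMLTest p W → q ∉ ⋂ n, testComponent W n}

/-! ### Chaitin's number -/

/-- A prefix-free machine: a partial computable function on binary words whose domain contains no
two distinct words one of which is a prefix of the other. -/
def IsPrefixFreeMachine (M : List Bool →. List Bool) : Prop :=
  Partrec M ∧ ∀ σ τ, (M σ).Dom → (M τ).Dom → σ <+: τ → σ = τ

/-- A universal (also: optimal) prefix-free machine: it simulates every prefix-free machine `M`
with an increase of the length of programs by at most a constant that depends only on `M`. -/
def IsUniversalPrefixFree (U : List Bool →. List Bool) : Prop :=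
  IsPrefixFreeMachine U ∧
    ∀ M, IsPrefixFreeMachine M →
      ∃ d : ℕ, ∀ σ y, y ∈ M σ → ∃ τ, y ∈ U τ ∧ τ.length ≤ σ.length + d

/-- The halting probability `∑ 2^{-|σ|}`, summed over all words `σ` in the domain of `U`, as a real
number. -/
noncomputable def haltingProbability (U : List Bool →. List Bool) : ℝ :=
  ∑' σ : {σ : List Bool // (U σ).Dom}, (2⁻¹ : ℝ) ^ (σ : List Bool).length

/-- Chaitin's number `Ω` of the machine `U` as a point of Cantor space: the sequence of the binary
digits of the halting probability of `U`. -/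
noncomputable def chaitinOmega (U : List Bool →. List Bool) : Cantor :=
  fun n => decide (Real.digits (haltingProbability U) 2 n = 1)

/-- `p` is low for `Ω`: the number `Ω` of the machine `U` is Martin-Löf random relative to `p`. -/
def IsLowForOmega (U : List Bool →. List Bool) (p : Cantor) : Prop :=
  chaitinOmega U ∈ MLR p

end LowForOmega

/-!
The number `Ω` is the limit of a computable increasing sequence of rationals, so the sequence of its
digits is limit computable: there is a primitive recursive `d` with `d j t = Ω j` for all large `t`
(`exists_primrec_limit_chaitinOmega`). Nothing else about `Ω` matters.

Suppose that `p` has, for infinitely many `m`, a block of zeros starting at position `m` which is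
longer than the time the approximation takes to settle on its first `m` bits. Relative to such a `p`
one can guess, for each `m`, the first `m` bits of `Ω`: take the value of the approximation at the
stage where the block of zeros ends. The guesses of length greater than `n` form the `n`-th
component of a Martin-Löf test relative to `p`, since there is one guess for each length, and
infinitely many of the guesses are correct, so that the test captures `Ω` (`isMLTest_guess`,
`notMem_MLR_of_notMem_closure`).

The complement of this set of oracles is contained in the union over `i` of the sets of those `p`
that have, for every `m ≥ i`, a `1` at some position `m + k` such that the approximation on `m` bits
is revised at a stage `s ≥ k`. Such a revision is a `Σ₁` event, so the points `σ1^ω` that have this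
property for all `m` with `i ≤ m < |σ|` can be enumerated, and the `i`-th closed set is the closure
of the set of these points (`isComputableDoubleSeq_listedPoint`, `exists_settled_of_notMem_closure`).
It is nowhere dense because a sufficiently long block of zeros can be inserted after any word
(`isNowhereDense_listedPoint`). The points that end in zeros, for which a block never ends, are put
into the closed sets as well.
-/

namespace LowForOmega

open Filter Topology MeasureTheory

/-! ### Words and the topology of Cantor space -/

/-- The point that begins with the word `σ` and continues with the constant bit `b`. -/
def pad (σ : List Bool) (b : Bool) : Cantor := fun n => σ.getD n b

/-- The word formed by the first `n` bits of `p`. -/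
def initialWord (p : Cantor) (n : ℕ) : List Bool := (List.range n).map p

@[simp] lemma length_initialWord (p : Cantor) (n : ℕ) : (initialWord p n).length = n := by
  simp [initialWord]

lemma initialWord_getD {p : Cantor} {n i : ℕ} (h : i < n) (b : Bool) :
    (initialWord p n).getD i b = p i := by
  simp [initialWord, List.getD, h]

lemma initialWord_getD_of_le {p : Cantor} {n i : ℕ} (h : n ≤ i) (b : Bool) :
    (initialWord p n).getD i b = b := by
  simp [initialWord, List.getD, h]

lemma exists_agree_subset_of_isOpen {O : Set Cantor} (hO : IsOpen O) {x : Cantor} (hx : x ∈ O) :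
    ∃ n, ∀ y : Cantor, (∀ i < n, y i = x i) → y ∈ O := by
  obtain ⟨I, u, hu, hsub⟩ := isOpen_pi_iff.1 hO x hx
  refine ⟨I.sup id + 1, fun y hy => hsub fun i hi => ?_⟩
  rw [hy i (Nat.lt_succ_of_le (Finset.le_sup (f := id) hi))]
  exact (hu i hi).2

lemma isOpen_agree (x : Cantor) (n : ℕ) : IsOpen {y : Cantor | ∀ i < n, y i = x i} := by
  have : {y : Cantor | ∀ i < n, y i = x i} = ⋂ i ∈ Set.Iio n, {y : Cantor | y i = x i} := by
    ext; simp
  rw [this]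
  exact (Set.finite_Iio n).isOpen_biInter fun i _ => by
    change IsOpen ((fun y : Cantor => y i) ⁻¹' {x i})
    exact (isOpen_discrete _).preimage (continuous_apply i)

lemma exists_agree_of_notMem_closure {S : Set Cantor} {x : Cantor} (h : x ∉ closure S) :
    ∃ n, ∀ y ∈ S, ∃ i < n, y i ≠ x i := by
  obtain ⟨n, hn⟩ := exists_agree_subset_of_isOpen isClosed_closure.isOpen_compl h
  refine ⟨n, fun y hy => ?_⟩
  by_contra! hc
  exact hn y hc (subset_closure hy)

/-- A set is nowhere dense as soon as every cylinder contains a cylinder that misses the set. -/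
lemma isNowhereDense_of_forall_exists {S : Set Cantor}
    (h : ∀ (x : Cantor) (n : ℕ), ∃ (z : Cantor) (N : ℕ), (∀ i < n, z i = x i) ∧
      ∀ y ∈ S, ∃ i < N, y i ≠ z i) : IsNowhereDense S := by
  rw [IsNowhereDense, Set.eq_empty_iff_forall_notMem]
  intro x hx
  obtain ⟨n, hn⟩ := exists_agree_subset_of_isOpen isOpen_interior hx
  obtain ⟨z, N, hz, hS⟩ := h x n
  obtain ⟨y, hy, hyS⟩ := mem_closure_iff.1 (interior_subset (hn z hz)) _ (isOpen_agree z N)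
    fun _ _ => rfl
  obtain ⟨i, hi, hne⟩ := hS y hyS
  exact hne (hy i hi)

/-! ### The uniform measure -/

lemma wordCylinder_eq_pi (σ : List Bool) :
    wordCylinder σ = Set.pi (Finset.range σ.length : Set ℕ) fun i => {σ.getD i false} := by
  ext x
  simp only [wordCylinder, Set.mem_ofPred_eq, Set.mem_pi, Finset.coe_range, Set.mem_Iio,
    Set.mem_singleton_iff]
  exact forall_congr' fun i => forall_congr' fun h => by simp [List.getD, h]

lemma measurableSet_wordCylinder (σ : List Bool) : MeasurableSet (wordCylinder σ) := by
  rw [wordCylinder_eq_pi]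
  exact MeasurableSet.pi (Finset.countable_toSet _) fun _ _ => MeasurableSet.singleton _

lemma measure_wordCylinder (σ : List Bool) :
    uniformMeasure (wordCylinder σ) = 2⁻¹ ^ σ.length := by
  rw [wordCylinder_eq_pi, uniformMeasure,
    Measure.infinitePi_pi _ fun _ _ => MeasurableSet.singleton _]
  simp

/-- A component of a test that enumerates at most one word of each length greater than `n`, and no
shorter words, is small enough: `∑_{m > n} 2^{-m} = 2^{-n}`. -/
lemma measure_testComponent_le {W : Set (ℕ × List Bool)} {n : ℕ}
    (hlen : ∀ σ, (n, σ) ∈ W → n < σ.length)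
    (huniq : ∀ σ τ, (n, σ) ∈ W → (n, τ) ∈ W → σ.length = τ.length → σ = τ) :
    uniformMeasure (testComponent W n) ≤ (2⁻¹ : ENNReal) ^ n := by
  have hsub : testComponent W n ⊆
      ⋃ m : ℕ, ⋃ σ ∈ {σ | (n, σ) ∈ W ∧ σ.length = n + 1 + m}, wordCylinder σ := by
    intro x hx
    simp only [testComponent, Set.mem_iUnion, Set.mem_ofPred_eq] at hx ⊢
    obtain ⟨σ, hσ, hx⟩ := hx
    exact ⟨σ.length - (n + 1), σ, ⟨hσ, by have := hlen σ hσ; omega⟩, hx⟩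
  have hle : ∀ m : ℕ, uniformMeasure
      (⋃ σ ∈ {σ | (n, σ) ∈ W ∧ σ.length = n + 1 + m}, wordCylinder σ) ≤ 2⁻¹ ^ (n + 1 + m) := by
    intro m
    rcases Set.eq_empty_or_nonempty {σ | (n, σ) ∈ W ∧ σ.length = n + 1 + m} with he | ⟨τ, hτ⟩
    · simp [he]
    · have : {σ | (n, σ) ∈ W ∧ σ.length = n + 1 + m} = {τ} := by
        ext σ
        refine ⟨fun h => huniq σ τ h.1 hτ.1 (h.2.trans hτ.2.symm), ?_⟩
        rintro rfl
        exact hτ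
      rw [this]
      simp [measure_wordCylinder, hτ.2]
  calc uniformMeasure (testComponent W n)
      ≤ ∑' m : ℕ, (2⁻¹ : ENNReal) ^ (n + 1 + m) :=
        (measure_mono hsub).trans ((measure_iUnion_le _).trans (ENNReal.tsum_le_tsum hle))
    _ = 2⁻¹ ^ n := by
        simp_rw [pow_add _ (n + 1)]
        rw [ENNReal.tsum_mul_left, ENNReal.tsum_geometric, ENNReal.one_sub_inv_two, inv_inv,
          pow_succ, mul_assoc, ENNReal.inv_mul_cancel (by simp) (by simp), mul_one]

lemma initialWord_length_eq {σ : List Bool} {x : Cantor} (h : x ∈ wordCylinder σ) :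
    initialWord x σ.length = σ :=
  List.ext_getElem (by simp) fun i _ hi => by simpa [initialWord] using h i hi

lemma initialWord_prefix (x : Cantor) {m n : ℕ} (h : m ≤ n) :
    initialWord x m <+: initialWord x n := by
  obtain ⟨l, rfl⟩ := Nat.exists_eq_add_of_le h
  exact ⟨(List.range l).map fun i => x (m + i), by simp [initialWord, List.range_add]⟩

/-- Kraft's inequality, qualitatively: the cylinders of the words in the domain of a prefix-free
machine are disjoint, so their measures have a finite sum. -/
lemma summable_of_isPrefixFreeMachine {M : List Bool →. List Bool} (hM : IsPrefixFreeMachine M) :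
    Summable fun σ : {σ : List Bool // (M σ).Dom} => (2⁻¹ : ℝ) ^ (σ : List Bool).length := by
  have hdisj : Pairwise (Function.onFun Disjoint
      fun σ : {σ : List Bool // (M σ).Dom} => wordCylinder σ) := by
    refine fun σ τ hne => Set.disjoint_left.2 fun x hσ hτ => hne (Subtype.ext ?_)
    rw [← initialWord_length_eq hσ, ← initialWord_length_eq hτ]
    have hp : ∀ m n, initialWord x m <+: initialWord x n ∨ initialWord x n <+: initialWord x m :=
      fun m n => (le_total m n).imp (initialWord_prefix x) (initialWord_prefix x)
    rcases hp (σ : List Bool).length (τ : List Bool).length with h | h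
    · rw [initialWord_length_eq hσ, initialWord_length_eq hτ] at h ⊢
      exact hM.2 _ _ σ.2 τ.2 h
    · rw [initialWord_length_eq hσ, initialWord_length_eq hτ] at h ⊢
      exact (hM.2 _ _ τ.2 σ.2 h).symm
  have : IsProbabilityMeasure uniformMeasure := by
    unfold uniformMeasure
    infer_instance
  have hle := (tsum_meas_le_meas_iUnion_of_disjoint uniformMeasure
    (fun σ : {σ : List Bool // (M σ).Dom} => measurableSet_wordCylinder σ) hdisj).trans
    prob_le_one
  refine (ENNReal.summable_toReal (ne_top_of_le_ne_top ENNReal.one_ne_top hle)).congr fun σ => ?_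
  simp [measure_wordCylinder]

/-! ### Sets c.e. in an oracle -/

lemma recursiveIn_comp_total {O : Set (ℕ →. ℕ)} {f : ℕ →. ℕ} {g : ℕ → ℕ}
    (hf : Nat.RecursiveIn O f) (hg : Nat.RecursiveIn O fun n => Part.some (g n)) :
    Nat.RecursiveIn O fun n => f (g n) :=
  (hf.comp hg).of_eq fun n => Part.bind_some (g n) f

lemma recursiveIn_pair_total {O : Set (ℕ →. ℕ)} {f g : ℕ → ℕ}
    (hf : Nat.RecursiveIn O fun n => Part.some (f n))
    (hg : Nat.RecursiveIn O fun n => Part.some (g n)) :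
    Nat.RecursiveIn O fun n => Part.some (Nat.pair (f n) (g n)) :=
  (hf.pair hg).of_eq fun n => by simp [Seq.seq]

lemma recursiveIn_of_primrec {O : Set (ℕ →. ℕ)} {f : ℕ → ℕ} (hf : Primrec f) :
    Nat.RecursiveIn O fun n => Part.some (f n) :=
  (Primrec.nat_iff.1 hf).recursiveIn

lemma initialWord_succ (p : Cantor) (n : ℕ) :
    initialWord p (n + 1) = initialWord p n ++ [p n] := by
  simp [initialWord, List.range_succ]

/-- The map `n ↦ p↾n` is recursive in `p`. This is the only use of the oracle itself. -/
lemma initialWord_recursiveIn (p : Cantor) :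
    Nat.RecursiveIn {oracle p} fun n => Part.some (Encodable.encode (initialWord p n)) := by
  let step : ℕ → ℕ := fun n =>
    Encodable.encode (((Encodable.decode (α := List Bool) n.unpair.1).getD []) ++
      [decide (n.unpair.2 = 1)])
  have hstep : Primrec step := by
    have hu := Primrec.unpair
    refine Primrec.encode.comp (Primrec.list_append.comp ?_ (Primrec.list_cons.comp ?_
      (Primrec.const [])))
    · exact Primrec.option_getD.comp (Primrec.decode.comp (Primrec.fst.comp hu)) (Primrec.const [])
    · exact (Primrec.eq.comp (Primrec.snd.comp hu) (Primrec.const 1)).decide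
  have hr : Primrec fun n : ℕ => n.unpair.2.unpair.2 :=
    Primrec.snd.comp (Primrec.unpair.comp (Primrec.snd.comp Primrec.unpair))
  have hl : Primrec fun n : ℕ => n.unpair.2.unpair.1 :=
    Primrec.fst.comp (Primrec.unpair.comp (Primrec.snd.comp Primrec.unpair))
  have hp : Nat.RecursiveIn {oracle p} (oracle p) := Nat.RecursiveIn.oracle _ rfl
  have hpl : Nat.RecursiveIn {oracle p} fun n => Part.some (p n.unpair.2.unpair.1).toNat :=
    recursiveIn_comp_total (f := oracle p) hp (recursiveIn_of_primrec hl)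
  have h := recursiveIn_comp_total (Nat.RecursiveIn.prec
    (recursiveIn_of_primrec (O := {oracle p}) (Primrec.const (Encodable.encode ([] : List Bool))))
    (recursiveIn_comp_total (recursiveIn_of_primrec hstep) (recursiveIn_pair_total
      (recursiveIn_of_primrec hr) hpl)))
    (recursiveIn_of_primrec (Primrec₂.natPair.comp (Primrec.const 0) Primrec.id))
  refine h.of_eq fun n => ?_
  simp only [Nat.unpair_pair, id]
  induction n with
  | zero => rfl
  | succ n ih =>
    simp only at ih ⊢
    rw [ih, initialWord_succ]
    cases hb : p n <;> simp [step]

lemma rfind_some_dom (b : ℕ → Bool) :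
    (Nat.rfind fun n => Part.some (b n)).Dom ↔ ∃ n, b n = true :=
  Nat.rfind_dom.trans ⟨fun ⟨n, h, _⟩ => ⟨n, (Part.mem_some_iff.1 h).symm⟩,
    fun ⟨n, h⟩ => ⟨n, Part.mem_some_iff.2 h.symm, fun _ => trivial⟩⟩

/-- A set that is `Σ₁` in the initial words of `p` is c.e. in `p`. -/
lemma isCEIn_setOf_exists_initialWord {α : Type} [Primcodable α] (p : Cantor)
    {R : α → List Bool → Prop} (hR : PrimrecRel R) :
    IsCEIn p {a | ∃ n, R a (initialWord p n)} := by
  classical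
  -- the code of a pair `(a, σ)` is sent to `0` if `R a σ` holds, and to `1` otherwise
  let g : ℕ → ℕ := fun n => Option.casesOn (Encodable.decode (α := α × List Bool) n) 1
    fun c => if R c.1 c.2 then 0 else 1
  have hg : Primrec g :=
    Primrec.option_casesOn Primrec.decode (Primrec.const 1)
      (Primrec.ite (hR.comp (Primrec.fst.comp Primrec.snd) (Primrec.snd.comp Primrec.snd))
        (Primrec.const 0) (Primrec.const 1)).to₂
  have hsearch := Nat.RecursiveIn.rfind (recursiveIn_comp_total
    (recursiveIn_of_primrec (O := {oracle p}) hg) (recursiveIn_pair_total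
    (recursiveIn_of_primrec (Primrec.fst.comp Primrec.unpair))
    (recursiveIn_comp_total
      (f := fun n => Part.some (Encodable.encode (initialWord p n))) (initialWord_recursiveIn p)
      (recursiveIn_of_primrec (Primrec.snd.comp Primrec.unpair)))))
  have h := (recursiveIn_of_primrec (O := {oracle p}) (Primrec.const 0)).comp hsearch
  refine ⟨fun a => ⟨∃ n, R a (initialWord p n), fun _ => ()⟩, h.of_eq fun n => ?_, fun a => Iff.rfl⟩
  simp only [Nat.unpair_pair]
  refine Part.ext' ?_ fun h₁ h₂ => ?_
  · change (Part.bind _ _).Dom ↔ (Part.bind _ _).Dom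
    simp only [Part.map_eq_map, Part.map_some, Part.bind_some_eq_map, Part.map_Dom]
    refine (rfind_some_dom _).trans ?_
    cases hn : Encodable.decode (α := α) n with
    | none => simp [g, Encodable.decode_prod_val, hn]
    | some a =>
      have hz : ∀ σ, g (Nat.pair n (Encodable.encode σ)) = 0 ↔ R a σ := fun σ => by
        simp [g, Encodable.decode_prod_val, hn]
      simp [hz]
  · obtain ⟨_, _, h₁'⟩ := Part.mem_bind_iff.1 (Part.get_mem h₁)
    obtain ⟨_, _, h₂'⟩ := Part.mem_bind_iff.1 (Part.get_mem h₂)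
    obtain ⟨_, _, h₂'⟩ := (Part.mem_map_iff _).1 h₂'
    exact (Part.mem_some_iff.1 h₁').trans h₂'

/-! ### Bounded quantifiers and primitive recursion -/

lemma primrecPred_forall_lt {β : Type*} [Primcodable β] {R : ℕ × β → Prop} (hR : PrimrecPred R)
    {f : β → ℕ} (hf : Primrec f) : PrimrecPred fun b => ∀ x < f b, R (x, b) :=
  ((PrimrecRel.forall_mem_list (R := fun x b => R (x, b)) hR).comp
    (Primrec.list_range.comp hf) Primrec.id).of_eq fun b => by simp

lemma primrecPred_exists_lt {β : Type*} [Primcodable β] {R : ℕ × β → Prop} (hR : PrimrecPred R)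
    {f : β → ℕ} (hf : Primrec f) : PrimrecPred fun b => ∃ x < f b, R (x, b) :=
  ((PrimrecRel.exists_mem_list (R := fun x b => R (x, b)) hR).comp
    (Primrec.list_range.comp hf) Primrec.id).of_eq fun b => by simp

lemma primrec_pad : Primrec fun c : (List Bool × Bool) × ℕ => pad c.1.1 c.1.2 c.2 := by
  refine (Primrec.option_getD.comp (Primrec.list_getElem?.comp (Primrec.fst.comp Primrec.fst)
    Primrec.snd) (Primrec.snd.comp Primrec.fst)).of_eq fun x => ?_
  simp [pad, List.getD]

/-! ### The computable sequence of closed sets -/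

/-- `Fits d i σ t`: for each `m` with `i ≤ m < |σ|`, the point `σ1^ω` has a `1` at some position
`m + k` such that one of the first `m` bits of the approximation `d · k` is revised at a stage
`s ≥ k`, and all this is witnessed by numbers below `t`. -/
def Fits (d : ℕ → ℕ → Bool) (i : ℕ) (σ : List Bool) (t : ℕ) : Prop :=
  ∀ m < σ.length, i ≤ m → ∃ k < t, ∃ s < t, ∃ j < m,
    k ≤ s ∧ pad σ true (m + k) = true ∧ d j s ≠ d j k

/-- `Listed d i (b, σ, t)`: the point `σb^ω` is to be put on the list for the `i`-th closed set, either
because `b = 1` and `σ` fits with witnesses below `t`, or because `b = 0` and `|σ| ≤ i`. -/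
def Listed (d : ℕ → ℕ → Bool) (i : ℕ) (c : Bool × List Bool × ℕ) : Prop :=
  (c.1 = true ∧ Fits d i c.2.1 c.2.2) ∨ (c.1 = false ∧ c.2.1.length ≤ i)

lemma primrecPred_fits {d : ℕ → ℕ → Bool} (hd : Primrec₂ d) :
    PrimrecPred fun c : ℕ × List Bool × ℕ => Fits d c.1 c.2.1 c.2.2 := by
  classical
  have h0 : PrimrecPred fun y : ℕ × ℕ × ℕ × ℕ × ℕ × List Bool × ℕ =>
      y.2.2.1 ≤ y.2.1 ∧ pad y.2.2.2.2.2.1 true (y.2.2.2.1 + y.2.2.1) = true ∧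
        d y.1 y.2.1 ≠ d y.1 y.2.2.1 := by
    have hj := Primrec.fst (α := ℕ) (β := ℕ × ℕ × ℕ × ℕ × List Bool × ℕ)
    have hs := Primrec.fst.comp (Primrec.snd (α := ℕ) (β := ℕ × ℕ × ℕ × ℕ × List Bool × ℕ))
    have h1 := Primrec.snd.comp (Primrec.snd (α := ℕ) (β := ℕ × ℕ × ℕ × ℕ × List Bool × ℕ))
    have hk := Primrec.fst.comp h1
    have h2 := Primrec.snd.comp h1
    have hm := Primrec.fst.comp h2
    have hσ := Primrec.fst.comp (Primrec.snd.comp (Primrec.snd.comp h2))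
    exact (Primrec.nat_le.comp hk hs).and ((Primrec.eq.comp (primrec_pad.comp
      ((hσ.pair (Primrec.const true)).pair (Primrec.nat_add.comp hm hk)))
      (Primrec.const true)).and (Primrec.eq.comp (hd.comp hj hs) (hd.comp hj hk)).not)
  have h1 := primrecPred_exists_lt h0 (Primrec.fst.comp (Primrec.snd.comp Primrec.snd))
  have h2 := primrecPred_exists_lt h1
    (Primrec.snd.comp (Primrec.snd.comp (Primrec.snd.comp Primrec.snd)))
  have h3 := primrecPred_exists_lt h2
    (Primrec.snd.comp (Primrec.snd.comp Primrec.snd))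
  have h4 := (Primrec.nat_le.comp (Primrec.fst.comp Primrec.snd)
    (Primrec.fst (α := ℕ) (β := ℕ × List Bool × ℕ))).not.or h3
  refine (primrecPred_forall_lt h4
    (Primrec.list_length.comp (Primrec.fst.comp Primrec.snd))).of_eq fun c => ?_
  simp only [Fits, imp_iff_not_or]

lemma primrecPred_listed {d : ℕ → ℕ → Bool} (hd : Primrec₂ d) :
    PrimrecPred fun c : ℕ × Bool × List Bool × ℕ => Listed d c.1 c.2 := by
  have hb := Primrec.fst.comp (Primrec.snd (α := ℕ) (β := Bool × List Bool × ℕ))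
  have hc := Primrec.snd.comp (Primrec.snd (α := ℕ) (β := Bool × List Bool × ℕ))
  exact ((Primrec.eq.comp hb (Primrec.const true)).and
    ((primrecPred_fits hd).comp (Primrec.fst.pair hc))).or
    ((Primrec.eq.comp hb (Primrec.const false)).and
      (Primrec.nat_le.comp (Primrec.list_length.comp (Primrec.fst.comp hc)) Primrec.fst))

open Classical in
/-- The double sequence in `2^ℕ ⊔ {∞}` whose `i`-th row lists the points described by `Listed d i`,
the triples `(b, σ, t)` being coded by numbers. -/
noncomputable def listedPoint (d : ℕ → ℕ → Bool) (i n : ℕ) : Option Cantor :=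
  (Encodable.decode (α := Bool × List Bool × ℕ) n).bind fun c =>
    if Listed d i c then some (pad c.2.1 c.1) else none

lemma isComputableDoubleSeq_listedPoint {d : ℕ → ℕ → Bool} (hd : Primrec₂ d) :
    IsComputableDoubleSeq (listedPoint d) := by
  classical
  have h : Primrec₂ fun (t : ℕ × ℕ × ℕ) (c : Bool × List Bool × ℕ) =>
      if Listed d t.1 c then some (pad c.2.1 c.1 t.2.2) else none := by
    have hc := Primrec.snd (α := ℕ × ℕ × ℕ) (β := Bool × List Bool × ℕ)
    have ht := Primrec.fst (α := ℕ × ℕ × ℕ) (β := Bool × List Bool × ℕ)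
    exact Primrec.ite ((primrecPred_listed hd).comp ((Primrec.fst.comp ht).pair hc))
      (Primrec.option_some.comp (primrec_pad.comp
        (((Primrec.fst.comp (Primrec.snd.comp hc)).pair (Primrec.fst.comp hc)).pair
          (Primrec.snd.comp (Primrec.snd.comp ht))))) (Primrec.const none)
  refine ((Primrec.option_bind (Primrec.decode.comp (Primrec.fst.comp Primrec.snd)) h).of_eq
    fun t => ?_).to_comp
  simp only [listedPoint]
  cases Encodable.decode (α := Bool × List Bool × ℕ) t.2.1 with
  | none => rfl
  | some c => by_cases hl : Listed d t.1 c <;> simp [hl]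

lemma exists_listedPoint_eq_some {d : ℕ → ℕ → Bool} {i : ℕ} {y : Cantor} :
    (∃ n, listedPoint d i n = some y) ↔
      ∃ σ, y = pad σ true ∧ (∃ t, Fits d i σ t) ∨ y = pad σ false ∧ σ.length ≤ i := by
  constructor
  · rintro ⟨n, hn⟩
    obtain ⟨⟨b, σ, t⟩, -, hc⟩ := Option.bind_eq_some_iff.1 hn
    split_ifs at hc with hl
    cases hc
    refine ⟨σ, ?_⟩
    rcases hl with ⟨hb, h⟩ | ⟨hb, h⟩ <;> simp only at hb <;> subst hb
    · exact .inl ⟨rfl, t, h⟩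
    · exact .inr ⟨rfl, h⟩
  · rintro ⟨σ, ⟨rfl, t, h⟩ | ⟨rfl, h⟩⟩
    · refine ⟨Encodable.encode (true, σ, t), ?_⟩
      rw [listedPoint, Encodable.encodek]
      simp [Listed, h]
    · refine ⟨Encodable.encode (false, σ, 0), ?_⟩
      rw [listedPoint, Encodable.encodek]
      simp [Listed, h]

/-! ### The closed sets are nowhere dense -/

lemma eventually_forall_lt_eq {d : ℕ → ℕ → Bool} {Z : Cantor}
    (hZ : ∀ j, ∀ᶠ t in atTop, d j t = Z j) (m : ℕ) : ∃ T, ∀ t ≥ T, ∀ j < m, d j t = Z j :=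
  eventually_atTop.1 ((eventually_all_finite (Set.finite_Iio m)).2 fun j _ => hZ j)

/-- Listed points cannot begin with a word that has zeros from position `m ≥ i` onwards for longer
than the approximation takes to settle on `m` bits, followed by a `1`. -/
lemma isNowhereDense_listedPoint {d : ℕ → ℕ → Bool} {Z : Cantor}
    (hZ : ∀ j, ∀ᶠ t in atTop, d j t = Z j) (i : ℕ) :
    IsNowhereDense {y : Cantor | ∃ n, listedPoint d i n = some y} := by
  refine isNowhereDense_of_forall_exists fun x n => ?_
  obtain ⟨T, hT⟩ := eventually_forall_lt_eq hZ (max n i)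
  set m := max n i
  have hnm : n ≤ m := le_max_left _ _
  have him : i ≤ m := le_max_right _ _
  refine ⟨fun k => if k < n then x k else decide (k = m + T + 1), m + T + 2,
    fun k hk => if_pos hk, fun y hy => ?_⟩
  by_contra! hyz
  have hy0 : ∀ k ≤ T, y (m + k) = false := fun k hk => by
    rw [hyz _ (by omega), if_neg (by omega)]
    simp
    omega
  obtain ⟨σ, ⟨rfl, t, hfit⟩ | ⟨rfl, hσ⟩⟩ := exists_listedPoint_eq_some.1 hy
  · have hmσ : m < σ.length := by
      by_contra! h
      have h0 := hy0 0 (Nat.zero_le _)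
      simp [pad, List.getD, List.getElem?_eq_none_iff.2 h] at h0
    obtain ⟨k, -, s, -, j, hj, hks, hk, hne⟩ := hfit m hmσ him
    have hTk : T < k := by
      by_contra! h
      simp [hy0 k h] at hk
    exact hne ((hT s (by omega) j hj).trans (hT k hTk.le j hj).symm)
  · have h1 := hyz (m + T + 1) (by omega)
    rw [if_neg (by omega)] at h1
    have h : σ.length ≤ m + T + 1 := by omega
    simp [pad, List.getD, List.getElem?_eq_none_iff.2 h] at h1

/-! ### The test that captures the limit -/

/-- `Guess d (n, σ) τ`: the first `1` of `τ` from position `|σ|` onwards is its last bit, and `σ`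
consists of the first `|σ| > n` bits of the approximation `d` at stage `|τ|`. -/
def Guess (d : ℕ → ℕ → Bool) (c : ℕ × List Bool) (τ : List Bool) : Prop :=
  c.1 < c.2.length ∧ c.2.length < τ.length ∧
    (∀ i < τ.length, c.2.length ≤ i → pad τ false i = decide (i + 1 = τ.length)) ∧
    ∀ j < c.2.length, pad c.2 false j = d j τ.length

lemma primrecRel_guess {d : ℕ → ℕ → Bool} (hd : Primrec₂ d) : PrimrecRel (Guess d) := by
  classical
  have hτ := Primrec.snd (α := ℕ × List Bool) (β := List Bool)
  have hn := Primrec.fst.comp (Primrec.fst (α := ℕ × List Bool) (β := List Bool))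
  have hσ := Primrec.snd.comp (Primrec.fst (α := ℕ × List Bool) (β := List Bool))
  have hlτ := Primrec.list_length.comp hτ
  have hlσ := Primrec.list_length.comp hσ
  have hi := Primrec.fst (α := ℕ) (β := (ℕ × List Bool) × List Bool)
  have hy := Primrec.snd (α := ℕ) (β := (ℕ × List Bool) × List Bool)
  have h1 := (Primrec.nat_le.comp (hlσ.comp hy) hi).not.or (Primrec.eq.comp
    (primrec_pad.comp (((hτ.comp hy).pair (Primrec.const false)).pair hi))
    (Primrec.eq.comp (Primrec.succ.comp hi) (hlτ.comp hy)).decide)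
  have h2 := Primrec.eq.comp
    (primrec_pad.comp (((hσ.comp hy).pair (Primrec.const false)).pair hi))
    (hd.comp hi (hlτ.comp hy))
  refine ((Primrec.nat_lt.comp hn hlσ).and ((Primrec.nat_lt.comp hlσ hlτ).and
    ((primrecPred_forall_lt h1 hlτ).and (primrecPred_forall_lt h2 hlσ)))).of_eq fun c => ?_
  simp only [Guess, imp_iff_not_or, Nat.succ_eq_add_one]

/-- For each length, the guesses enumerated relative to `p` contain at most one word, because the
stage is determined by the first `1` of `p` from the position given by the length. -/
lemma isMLTest_guess {d : ℕ → ℕ → Bool} (hd : Primrec₂ d) (p : Cantor) :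
    IsMLTest p {c | ∃ N, Guess d c (initialWord p N)} := by
  refine ⟨isCEIn_setOf_exists_initialWord p (primrecRel_guess hd), fun n => ?_⟩
  refine measure_testComponent_le (fun σ ⟨N, h⟩ => h.1) ?_
  rintro σ₁ σ₂ ⟨N₁, -, hlt₁, hone₁, hd₁⟩ ⟨N₂, -, hlt₂, hone₂, hd₂⟩ hlen
  simp only [length_initialWord] at *
  -- both stages are determined by the first `1` of `p` from the common length onwards
  have key : ∀ M N, σ₁.length < M → M < N →
      (∀ i < M, σ₁.length ≤ i → pad (initialWord p M) false i = decide (i + 1 = M)) →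
      ¬ ∀ i < N, σ₁.length ≤ i → pad (initialWord p N) false i = decide (i + 1 = N) := by
    intro M N hM hMN h h'
    have h := h (M - 1) (by omega) (by omega)
    have h' := h' (M - 1) (by omega) (by omega)
    rw [pad, initialWord_getD (by omega), decide_eq_true (by omega)] at h
    rw [pad, initialWord_getD (by omega), decide_eq_false (by omega), h] at h'
    exact Bool.noConfusion h'
  have hN : N₁ = N₂ := by
    rcases lt_trichotomy N₁ N₂ with h | h | h
    · exact absurd (hlen ▸ hone₂) (key _ _ hlt₁ h hone₁)
    · exact h
    · exact absurd hone₁ (key _ _ (hlen ▸ hlt₂) h (hlen ▸ hone₂))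
  subst hN
  refine List.ext_getElem hlen fun j h₁ h₂ => ?_
  have := (hd₁ j h₁).trans (hd₂ j h₂).symm
  simpa [pad, List.getD, h₁, h₂] using this

/-- Outside the `i`-th closed set, some `m ≥ i` has the property that the approximation has settled
on its first `m` bits at stage `k` whenever `p` has a `1` at position `m + k`. -/
lemma exists_settled_of_notMem_closure {d : ℕ → ℕ → Bool} {p : Cantor} {i : ℕ}
    (hp : p ∉ closure {y : Cantor | ∃ n, listedPoint d i n = some y}) :
    ∃ m ≥ i, ∀ k, p (m + k) = true → ∀ s ≥ k, ∀ j < m, d j s = d j k := by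
  obtain ⟨n, hn⟩ := exists_agree_of_notMem_closure hp
  by_contra! hc
  choose! k hk s hs j hj hne using hc
  -- a common bound for the finitely many witnesses
  let t := (Finset.range n).sup fun m => max (k m) (s m) + 1
  have ht : ∀ m < n, max (k m) (s m) + 1 ≤ t := fun m hm =>
    Finset.le_sup (f := fun m => max (k m) (s m) + 1) (Finset.mem_range.2 hm)
  have hfit : Fits d i (initialWord p n) t := by
    intro m hm him
    rw [length_initialWord] at hm
    have := ht m hm
    refine ⟨k m, by omega, s m, by omega, j m, hj m him, hs m him, ?_, hne m him⟩
    rcases lt_or_ge (m + k m) n with h | h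
    · rw [pad, initialWord_getD h, hk m him]
    · rw [pad, initialWord_getD_of_le h]
  obtain ⟨a, ha, hne'⟩ := hn _ (exists_listedPoint_eq_some.2 ⟨_, .inl ⟨rfl, t, hfit⟩⟩)
  exact hne' (initialWord_getD ha _)

/-- The points that vanish from position `i` onwards are listed in row `i`. -/
lemma exists_one_of_notMem_closure {d : ℕ → ℕ → Bool} {p : Cantor} {i : ℕ}
    (hp : p ∉ closure {y : Cantor | ∃ n, listedPoint d i n = some y}) :
    ∃ k ≥ i, p k = true := by
  by_contra! hc
  refine hp (subset_closure (exists_listedPoint_eq_some.2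
    ⟨initialWord p i, .inr ⟨?_, by simp⟩⟩))
  funext a
  rcases lt_or_ge a i with h | h
  · rw [pad, initialWord_getD h]
  · rw [pad, initialWord_getD_of_le h]
    simpa using hc a h

lemma notMem_MLR_of_notMem_closure {d : ℕ → ℕ → Bool} (hd : Primrec₂ d) {Z : Cantor}
    (hZ : ∀ j, ∀ᶠ t in atTop, d j t = Z j) {p : Cantor}
    (hp : ∀ i, p ∉ closure {y : Cantor | ∃ n, listedPoint d i n = some y}) : Z ∉ MLR p := by
  intro hmem
  refine hmem _ (isMLTest_guess hd p) (Set.mem_iInter.2 fun n => ?_)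
  obtain ⟨m, hm, hset⟩ := exists_settled_of_notMem_closure (hp (n + 1))
  have hone : ∃ k, p (m + k) = true := by
    obtain ⟨k, hk, h⟩ := exists_one_of_notMem_closure (hp m)
    exact ⟨k - m, by rwa [Nat.add_sub_cancel' hk]⟩
  classical
  have hk := Nat.find_spec hone
  have hmin : ∀ l < Nat.find hone, p (m + l) = false := fun l hl => by
    simpa using Nat.find_min hone hl
  set k := Nat.find hone
  have hdig : ∀ s ≥ k, ∀ j < m, d j s = Z j := by
    intro s hs j hj
    obtain ⟨t, ht, hkt⟩ := ((hZ j).and (eventually_ge_atTop k)).exists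
    rw [hset k hk s hs j hj, ← hset k hk t hkt j hj, ht]
  simp only [testComponent, Set.mem_iUnion, Set.mem_ofPred_eq]
  refine ⟨initialWord Z m, ⟨m + k + 1, ?_, ?_, ?_, ?_⟩, ?_⟩
  · simp only [length_initialWord]; omega
  · simp only [length_initialWord]; omega
  · simp only [length_initialWord]
    intro a ha hma
    rw [pad, initialWord_getD ha]
    obtain ⟨l, rfl⟩ := Nat.exists_eq_add_of_le hma
    rcases (show l ≤ k by omega).lt_or_eq with hl | rfl
    · rw [hmin l hl]
      simp
      omega
    · simp [hk]
  · simp only [length_initialWord]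
    intro j hj
    rw [pad, initialWord_getD hj, hdig _ (by omega) j hj]
  · intro a ha
    simp [initialWord]

/-- For every limit computable point `Z` (with a primitive recursive approximation) there is a
co-c.e. comeager set of oracles relative to which `Z` is not random. -/
theorem exists_isCoCEComeager_notMem_MLR {d : ℕ → ℕ → Bool} (hd : Primrec₂ d) {Z : Cantor}
    (hZ : ∀ j, ∀ᶠ t in atTop, d j t = Z j) :
    ∃ A : Set Cantor, IsCoCEComeager A ∧ ∀ p ∈ A, Z ∉ MLR p := by
  refine ⟨(⋃ i, closure {y : Cantor | ∃ n, listedPoint d i n = some y})ᶜ,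
    ⟨_, ⟨listedPoint d, isComputableDoubleSeq_listedPoint hd, fun i => rfl⟩,
      fun i => (isNowhereDense_listedPoint hZ i).closure, compl_compl _⟩, fun p hp => ?_⟩
  exact notMem_MLR_of_notMem_closure hd hZ fun i hi => hp (Set.mem_iUnion.2 ⟨i, hi⟩)

/-! ### Chaitin's number is limit computable -/

/-- The contribution of the word with code `e` to `scaledStage c t`. The condition `encode σ = e`
prevents a word from being counted for several numbers that decode to it. -/
def scaledWeight (c : Nat.Partrec.Code) (t e : ℕ) : ℕ :=
  Option.casesOn (Encodable.decode (α := List Bool) e) 0 fun σ =>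
    if Encodable.encode σ = e ∧ (Nat.Partrec.Code.evaln t c e).isSome = true ∧ σ.length ≤ t then
      2 ^ (t - σ.length) else 0

/-- The sum `∑ 2^{-|σ|}` over the words `σ` of length at most `t` on which the code `c` is seen to
halt at stage `t`, multiplied by `2 ^ t` so as to be a natural number. -/
def scaledStage (c : Nat.Partrec.Code) (t : ℕ) : ℕ :=
  (List.range t).foldl (fun s e => s + scaledWeight c t e) 0

/-- The binary digit number `j` of `scaledStage c t / 2 ^ t`. -/
def stageDigit (c : Nat.Partrec.Code) (j t : ℕ) : Bool :=
  decide (scaledStage c t * 2 ^ (j + 1) / 2 ^ t % 2 = 1)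

lemma primrec_two_pow : Primrec fun n : ℕ => 2 ^ n :=
  (Primrec₂.unpaired'.1 Nat.Primrec.pow).comp (Primrec.const 2) Primrec.id

lemma primrec_scaledWeight (c : Nat.Partrec.Code) : Primrec₂ (scaledWeight c) := by
  have ht := Primrec.fst.comp (Primrec.fst (α := ℕ × ℕ) (β := List Bool))
  have he := Primrec.snd.comp (Primrec.fst (α := ℕ × ℕ) (β := List Bool))
  have hσ := Primrec.snd (α := ℕ × ℕ) (β := List Bool)
  have hl := Primrec.list_length.comp hσ
  exact Primrec.option_casesOn (Primrec.decode.comp Primrec.snd) (Primrec.const 0)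
    (Primrec.ite ((Primrec.eq.comp (Primrec.encode.comp hσ) he).and
      ((Primrec.eq.comp (Primrec.option_isSome.comp (Nat.Partrec.Code.primrec_evaln.comp
        ((ht.pair (Primrec.const c)).pair he))) (Primrec.const true)).and
        (Primrec.nat_le.comp hl ht)))
      (primrec_two_pow.comp (Primrec.nat_sub.comp ht hl)) (Primrec.const 0)).to₂

lemma primrec_scaledStage (c : Nat.Partrec.Code) : Primrec (scaledStage c) :=
  Primrec.list_foldl Primrec.list_range (Primrec.const 0)
    (Primrec.nat_add.comp (Primrec.fst.comp Primrec.snd)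
      ((primrec_scaledWeight c).comp Primrec.fst (Primrec.snd.comp Primrec.snd))).to₂

lemma primrec_stageDigit (c : Nat.Partrec.Code) : Primrec₂ (stageDigit c) :=
  (Primrec.eq.comp (Primrec.nat_mod.comp (Primrec.nat_div.comp
    (Primrec.nat_mul.comp ((primrec_scaledStage c).comp Primrec.snd)
      (primrec_two_pow.comp (Primrec.succ.comp Primrec.fst)))
    (primrec_two_pow.comp Primrec.snd)) (Primrec.const 2)) (Primrec.const 1)).decide

lemma scaledStage_eq_sum (c : Nat.Partrec.Code) (t : ℕ) :
    scaledStage c t = ∑ e ∈ Finset.range t, scaledWeight c t e := by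
  have : ∀ n, (List.range n).foldl (fun s e => s + scaledWeight c t e) 0 =
      ∑ e ∈ Finset.range n, scaledWeight c t e := by
    intro n
    induction n with
    | zero => rfl
    | succ n ih => rw [List.range_succ, List.foldl_append, ih, Finset.sum_range_succ]; rfl
  exact this t

lemma scaledWeight_encode (c : Nat.Partrec.Code) (t : ℕ) (σ : List Bool) :
    scaledWeight c t (Encodable.encode σ) =
      if (Nat.Partrec.Code.evaln t c (Encodable.encode σ)).isSome = true ∧ σ.length ≤ t then
        2 ^ (t - σ.length) else 0 := by
  simp [scaledWeight, Encodable.encodek]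

lemma scaledWeight_of_notMem_range (c : Nat.Partrec.Code) (t : ℕ) {e : ℕ}
    (he : e ∉ Set.range (Encodable.encode : List Bool → ℕ)) : scaledWeight c t e = 0 := by
  unfold scaledWeight
  cases h : Encodable.decode (α := List Bool) e with
  | none => rfl
  | some σ => exact if_neg fun hσ => he ⟨σ, hσ.1⟩

lemma scaledWeight_of_le (c : Nat.Partrec.Code) {t e : ℕ} (h : t ≤ e) : scaledWeight c t e = 0 := by
  unfold scaledWeight
  cases Encodable.decode (α := List Bool) e with
  | none => rfl
  | some σ =>
    refine if_neg fun hσ => ?_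
    obtain ⟨x, hx⟩ := Option.isSome_iff_exists.1 hσ.2.1
    exact absurd (Nat.Partrec.Code.evaln_bound hx) (by omega)

lemma exists_code_dom_iff {U : List Bool →. List Bool} (hU : Partrec U) :
    ∃ c : Nat.Partrec.Code, ∀ σ, (U σ).Dom ↔
      ∃ t, (Nat.Partrec.Code.evaln t c (Encodable.encode σ)).isSome = true := by
  obtain ⟨c, hc⟩ := Nat.Partrec.Code.exists_code.1 hU
  refine ⟨c, fun σ => ?_⟩
  have h : (c.eval (Encodable.encode σ)).Dom ↔ (U σ).Dom := by
    rw [hc]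
    simp [Encodable.encodek]
  rw [← h, Part.dom_iff_mem]
  simp only [Nat.Partrec.Code.evaln_complete, Option.isSome_iff_exists, Option.mem_def]
  exact exists_comm

lemma tendsto_scaledStage {U : List Bool →. List Bool} {c : Nat.Partrec.Code}
    (hc : ∀ σ, (U σ).Dom ↔
      ∃ t, (Nat.Partrec.Code.evaln t c (Encodable.encode σ)).isSome = true)
    (hs : Summable fun σ : {σ : List Bool // (U σ).Dom} => (2⁻¹ : ℝ) ^ (σ : List Bool).length) :
    Tendsto (fun t => (scaledStage c t : ℝ) / 2 ^ t) atTop (𝓝 (haltingProbability U)) := by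
  classical
  have hinj : Function.Injective
      fun σ : {σ : List Bool // (U σ).Dom} => Encodable.encode (σ : List Bool) :=
    Encodable.encode_injective.comp Subtype.val_injective
  let g : ℕ → ℝ := Function.extend
    (fun σ : {σ : List Bool // (U σ).Dom} => Encodable.encode (σ : List Bool))
    (fun σ => (2⁻¹ : ℝ) ^ (σ : List Bool).length) 0
  have hgσ : ∀ σ (h : (U σ).Dom), g (Encodable.encode σ) = 2⁻¹ ^ σ.length := fun σ h =>
    hinj.extend_apply _ _ ⟨σ, h⟩
  have hg0 : ∀ e, (∀ σ, (U σ).Dom → Encodable.encode σ ≠ e) → g e = 0 := fun e h =>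
    Function.extend_apply' _ _ _ fun ⟨σ, hσ⟩ => h σ.1 σ.2 hσ
  have hsum : HasSum g (haltingProbability U) := (hasSum_extend_zero hinj).2 hs.hasSum
  have hpow : ∀ {l t : ℕ}, l ≤ t → ((2 : ℝ) ^ (t - l)) / 2 ^ t = 2⁻¹ ^ l := by
    intro l t h
    rw [pow_sub₀ _ two_ne_zero h, inv_pow]
    field_simp
  have hstage : ∀ t, (scaledStage c t : ℝ) / 2 ^ t = ∑' e, (scaledWeight c t e : ℝ) / 2 ^ t := by
    intro t
    rw [tsum_eq_sum (s := Finset.range t), scaledStage_eq_sum, Nat.cast_sum, Finset.sum_div]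
    intro e he
    simp [scaledWeight_of_le c (show t ≤ e by simpa using he)]
  simp_rw [hstage]
  rw [← hsum.tsum_eq]
  refine tendsto_tsum_of_dominated_convergence hsum.summable (fun e => ?_)
    (Eventually.of_forall fun t e => ?_)
  · by_cases he : ∃ σ, (U σ).Dom ∧ Encodable.encode σ = e
    · obtain ⟨σ, hσ, rfl⟩ := he
      obtain ⟨T, hT⟩ := (hc σ).1 hσ
      refine tendsto_const_nhds.congr' ?_
      filter_upwards [eventually_ge_atTop T, eventually_ge_atTop σ.length] with t ht hl
      obtain ⟨x, hx⟩ := Option.isSome_iff_exists.1 hT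
      have : Nat.Partrec.Code.evaln t c (Encodable.encode σ) = some x :=
        Nat.Partrec.Code.evaln_mono ht hx
      simp [hgσ σ hσ, scaledWeight_encode, this, hl, hpow hl]
    · push Not at he
      rw [hg0 e he]
      have : ∀ t, scaledWeight c t e = 0 := by
        intro t
        by_cases hr : e ∈ Set.range (Encodable.encode : List Bool → ℕ)
        · obtain ⟨σ, rfl⟩ := hr
          rw [scaledWeight_encode, if_neg]
          exact fun h => he σ ((hc σ).2 ⟨t, h.1⟩) rfl
        · exact scaledWeight_of_notMem_range c t hr
      simp [this]
  · rw [Real.norm_of_nonneg (by positivity)]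
    by_cases hr : e ∈ Set.range (Encodable.encode : List Bool → ℕ)
    · obtain ⟨σ, rfl⟩ := hr
      rw [scaledWeight_encode]
      split_ifs with h
      · rw [hgσ σ ((hc σ).2 ⟨t, h.1⟩), ← hpow h.2]
        simp
      · by_cases hσ : (U σ).Dom
        · rw [hgσ σ hσ]
          simp
        · rw [hg0 _ fun τ hτ h => hσ (Encodable.encode_injective (a₁ := τ) (a₂ := σ) h ▸ hτ)]
          simp
    · rw [scaledWeight_of_notMem_range c t hr, hg0 _ fun σ _ h => hr ⟨σ, h⟩]
      simp

lemma chaitinOmega_apply (U : List Bool →. List Bool) (j : ℕ) :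
    chaitinOmega U j = decide (⌊haltingProbability U * 2 ^ (j + 1)⌋₊ % 2 = 1) := by
  simp only [chaitinOmega, Real.digits, Nat.cast_ofNat]
  congr 1
  rw [Fin.ext_iff]
  simp

/-- If `2 ^ (j + 1) Ω` is not an integer, then its integer part is locally constant around it, so
that digit number `j` of the approximations stabilizes at that of `Ω`. -/
lemma eventually_stageDigit_eq {U : List Bool →. List Bool} {c : Nat.Partrec.Code}
    (hc : Tendsto (fun t => (scaledStage c t : ℝ) / 2 ^ t) atTop (𝓝 (haltingProbability U)))
    {j : ℕ} (hj : ∀ k : ℕ, haltingProbability U * 2 ^ (j + 1) ≠ k) :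
    ∀ᶠ t in atTop, stageDigit c j t = chaitinOmega U j := by
  have hnonneg : 0 ≤ haltingProbability U := tsum_nonneg fun _ => by positivity
  have hlt : (⌊haltingProbability U * 2 ^ (j + 1)⌋₊ : ℝ) < haltingProbability U * 2 ^ (j + 1) :=
    lt_of_le_of_ne (Nat.floor_le (by positivity)) (hj _).symm
  have hlim := hc.mul_const ((2 : ℝ) ^ (j + 1))
  filter_upwards [hlim.eventually_const_lt hlt,
    hlim.eventually_lt_const (Nat.lt_floor_add_one _)] with t h1 h2
  have : ⌊(scaledStage c t : ℝ) / 2 ^ t * 2 ^ (j + 1)⌋₊ = scaledStage c t * 2 ^ (j + 1) / 2 ^ t := by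
    rw [div_mul_eq_mul_div]
    exact_mod_cast Nat.floor_div_eq_div (K := ℝ) (scaledStage c t * 2 ^ (j + 1)) (2 ^ t)
  rw [stageDigit, chaitinOmega_apply, ← this,
    (Nat.floor_eq_iff (by positivity)).2 ⟨h1.le, h2⟩]

lemma chaitinOmega_eq_false_of_dyadic {U : List Bool →. List Bool} {n k : ℕ}
    (h : haltingProbability U * 2 ^ n = k) {j : ℕ} (hj : n ≤ j) : chaitinOmega U j = false := by
  obtain ⟨l, rfl⟩ := Nat.exists_eq_add_of_le hj
  have : haltingProbability U * 2 ^ (n + l + 1) = ((k * 2 ^ l * 2 : ℕ) : ℝ) := by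
    push_cast
    rw [← h]
    ring
  rw [chaitinOmega_apply, this, Nat.floor_natCast]
  simp

/-- The sequence `Ω` is limit computable. For a dyadic rational, which approximations from below need
not approach digit by digit, it is computable, since it ends in zeros. -/
theorem exists_primrec_limit_chaitinOmega {U : List Bool →. List Bool}
    (hU : IsPrefixFreeMachine U) :
    ∃ d : ℕ → ℕ → Bool, Primrec₂ d ∧ ∀ j, ∀ᶠ t in atTop, d j t = chaitinOmega U j := by
  by_cases hdy : ∃ n k : ℕ, haltingProbability U * 2 ^ n = k
  · obtain ⟨n, k, h⟩ := hdy
    have hd : Primrec₂ fun j _ : ℕ => pad (initialWord (chaitinOmega U) n) false j :=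
      primrec_pad.comp
        ((Primrec.const (initialWord (chaitinOmega U) n, false)).pair Primrec.fst)
    refine ⟨_, hd, fun j => Eventually.of_forall fun t => ?_⟩
    rcases lt_or_ge j n with hj | hj
    · exact initialWord_getD hj _
    · rw [chaitinOmega_eq_false_of_dyadic h hj]
      exact initialWord_getD_of_le hj _
  · push Not at hdy
    obtain ⟨c, hc⟩ := exists_code_dom_iff hU.1
    exact ⟨stageDigit c, primrec_stageDigit c, fun j => eventually_stageDigit_eq
      (tendsto_scaledStage hc (summable_of_isPrefixFreeMachine hU)) (hdy (j + 1))⟩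

end LowForOmega

theorem proposition10p1 (U : List Bool →. List Bool)
    (hU : LowForOmega.IsUniversalPrefixFree U) :
    ∃ A : Set LowForOmega.Cantor, LowForOmega.IsCoCEComeager A ∧
      ∀ p ∈ A, ¬ LowForOmega.IsLowForOmega U p := by
  obtain ⟨d, hd, hlim⟩ := LowForOmega.exists_primrec_limit_chaitinOmega hU.1
  exact LowForOmega.exists_isCoCEComeager_notMem_MLR hd hlim
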